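/- Let $U=(U_y)_{y\in\mathbb Z}$ and $V=(V_x)_{x\in\mathbb Z}$ be random variables with values in $\{-1,1\}$, all independent and each with symmetric distribution, defined on one probability space. Let $\omega$ be the random directed graph on $\mathbb Z^2$ with edge set $$\omega=\big\{\big((x,y),\,(x+U_y,\,y+V_x)\big) : (x,y)\in\mathbb Z^2\big\},$$ that is, the union of the paths, from all starting points, of the walk that jumps from $(x,y)$ to $(x+U_y,y+V_x)$. Its connected components are those of the underlying undirected graph. A trap is a pair of opposite edges $(a,b),(b,a)\in\omega$ (a $2$-cycle). Then, almost surely, every connected component of $\omega$ is bounded and contains exactly one trap. In other words, almost surely, every connected component of $\omega$ is a finite tree rooted at a trap: it is finite, its underlying undirected graph (with the two opposite edges of a trap identified) is a tree, and from each of its vertices the directed path in $\omega$ leads to the trap. In particular, almost surely, no path of $\omega$ comes from infinity: there is no sequence $(a_n)_{n\ge0}$ of distinct vertices with $(a_{n+1},a_n)\in\omega$ for all $n\ge0$. -/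

import Mathlib

open MeasureTheory ProbabilityTheory

namespace Manhattan

/-- The directed edge set `ω`: given the orientations `u y` of the horizontal lines and `v x` of the
vertical lines, every vertex `(x, y)` has the single outgoing edge to `(x + u y, y + v x)`. -/
def omega (u v : ℤ → ℤ) : Set ((ℤ × ℤ) × (ℤ × ℤ)) :=
  {e | ∃ x y : ℤ, e = ((x, y), (x + u y, y + v x))}

/-- The undirected graph underlying a set of directed edges; its connected components are the
connected components of the edge set. -/
def graph (w : Set ((ℤ × ℤ) × (ℤ × ℤ))) : SimpleGraph (ℤ × ℤ) :=
  SimpleGraph.fromRel fun a b => (a, b) ∈ w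

/-- A trap is a pair of opposite edges of `w`, recorded by its unordered pair of endpoints. -/
def IsTrap (w : Set ((ℤ × ℤ) × (ℤ × ℤ))) (t : Sym2 (ℤ × ℤ)) : Prop :=
  ∃ a b : ℤ × ℤ, t = s(a, b) ∧ (a, b) ∈ w ∧ (b, a) ∈ w

/-- Both endpoints of the pair `t` lie in the connected component `C`. -/
def Contains {w : Set ((ℤ × ℤ) × (ℤ × ℤ))} (C : (graph w).ConnectedComponent)
    (t : Sym2 (ℤ × ℤ)) : Prop :=
  ∀ p ∈ t, p ∈ C.supp

/-- The component `C` is a finite tree rooted at `t`: it is finite, it is a tree once opposite edges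
are identified, it contains `t`, and all its edges lead towards `t`, that is, from every vertex of
`C` there are directed paths to the endpoints of `t`. -/
def IsFiniteTreeRootedAt {w : Set ((ℤ × ℤ) × (ℤ × ℤ))} (C : (graph w).ConnectedComponent)
    (t : Sym2 (ℤ × ℤ)) : Prop :=
  C.supp.Finite ∧ C.toSimpleGraph.IsTree ∧ Contains C t ∧
    ∀ p ∈ C.supp, ∀ q ∈ t, Relation.ReflTransGen (fun a b => (a, b) ∈ w) p q

/-- A path coming from infinity: distinct vertices `…, a 2, a 1, a 0`, with an edge of `w` from each
one to the next. -/
def IsPathFromInfinity (w : Set ((ℤ × ℤ) × (ℤ × ℤ))) (a : ℕ → ℤ × ℤ) : Prop :=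
  Function.Injective a ∧ ∀ n, (a (n + 1), a n) ∈ w

end Manhattan

/-!
The walk is the deterministic map `step u v`, so an edge of `ω` joins each vertex to its image, and the
structure of a component is decided by three facts.

* Cycles. The only cycles of `step u v` are the traps (`step_step_eq_of_periodic`). Let `A`, `B` have
  increments `u y + u (y + 1)` and `v x + v (x + 1)`. Along a step, `A y - B x` changes by the amount
  by which the walk turns, so a cycle has no turning in total (`sum_turning_eq_zero`). But a cycle
  other than a trap is a simple closed diagonal polygon, whose tangent makes a full turn by a
  discrete version of Hopf's Umlaufsatz (`sum_turnCrossing_ne_zero`).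

* Forward paths. Almost surely they are all bounded (`ae_finite_orbits`). By symmetry it is enough to
  bound them from above. Call row `M` a peak if the walk first arrives there in a column with
  downward orientation. The orientation of row `M` has not been used before, and reversing it turns
  the arrival of a walk that would escape upwards into a trap, so that `M` becomes its top row. As the
  top row is unique and the reversal preserves the law, the expected number of peaks, restricted to
  the event that the walk is unbounded above, is at most one. A walk with finitely many peaks that is unbounded above would finally go
  straight up between two downward columns, which the long runs of equal orientations of rows
  prevent.

* Backward trees. A bounded forward path ends in a cycle, hence in a trap. Let each vertex send mass
  one to the trap that it reaches. By translation invariance, the expected mass received at a vertex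
  is at most one, so almost surely only finitely many vertices lead to a given trap
  (`ae_finite_basins`).

Then each component consists of the vertices that lead to one trap, and it is a finite connected graph
with one edge fewer than vertices, that is, a tree (`components_of_finite`).
-/

namespace Manhattan

/-- One jump of the walk. -/
def step (u v : ℤ → ℤ) (p : ℤ × ℤ) : ℤ × ℤ := (p.1 + u p.2, p.2 + v p.1)

/-! ### The rotation number of a diagonal polygon -/

/-- Signed number of times that a diagonal step from `w` to `w'` crosses, counterclockwise, the
half-line from the origin in the direction `(1, 0)`, pushed slightly below it. This is only
meaningful for nonzero `w`, `w'` with even coordinate sum. -/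
def crossing (w w' : ℤ × ℤ) : ℤ :=
  if 0 < w.1 then (if 0 ≤ w'.2 then 1 else 0) - (if 0 ≤ w.2 then 1 else 0) else 0

/-- Crossings of the reference half-line when the direction rotates from `e` to `e'` through
`e + e'`. -/
def turnCrossing (e e' : ℤ × ℤ) : ℤ := crossing e (e + e') + crossing (e + e') e'

/-- The four diagonal unit directions. -/
def IsDiag (e : ℤ × ℤ) : Prop := (e.1 = -1 ∨ e.1 = 1) ∧ (e.2 = -1 ∨ e.2 = 1)

/-- The cochain `crossing` is closed: the two ways around a unit square that avoids the origin have
the same number of crossings. -/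
lemma crossing_square {w e f : ℤ × ℤ} (he : IsDiag e) (hf : IsDiag f) (hw : Even (w.1 + w.2))
    (h0 : w ≠ 0) (h1 : w + e ≠ 0) (h2 : w - f ≠ 0) (h3 : w + e - f ≠ 0) :
    crossing w (w - f) + crossing (w - f) (w + e - f) =
      crossing w (w + e) + crossing (w + e) (w + e - f) := by
  obtain ⟨x, y⟩ := w
  obtain ⟨a, b⟩ := e
  obtain ⟨c, d⟩ := f
  obtain ⟨k, hk⟩ := hw
  simp only [IsDiag, crossing, Prod.mk_add_mk, Prod.mk_sub_mk, ne_eq, Prod.mk_eq_zero, not_and]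
    at *
  rcases he with ⟨rfl | rfl, rfl | rfl⟩ <;> rcases hf with ⟨rfl | rfl, rfl | rfl⟩ <;>
    omega

section Secants

variable {z : ℕ → ℤ × ℤ}

lemma crossing_square_secant (hz : ∀ i, IsDiag (z (i + 1) - z i))
    (hpar : ∀ i j, Even ((z j - z i).1 + (z j - z i).2)) {k m : ℕ}
    (h0 : z k ≠ z m) (h1 : z k ≠ z (m + 1)) (h2 : z (k + 1) ≠ z m)
    (h3 : z (k + 1) ≠ z (m + 1)) :
    crossing (z m - z k) (z m - z (k + 1)) +
        crossing (z m - z (k + 1)) (z (m + 1) - z (k + 1)) =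
      crossing (z m - z k) (z (m + 1) - z k) +
        crossing (z (m + 1) - z k) (z (m + 1) - z (k + 1)) := by
  have a1 : z m - z (k + 1) = z m - z k - (z (k + 1) - z k) := by abel
  have a2 : z (m + 1) - z k = z m - z k + (z (m + 1) - z m) := by abel
  have a3 : z (m + 1) - z (k + 1) = z m - z k + (z (m + 1) - z m) - (z (k + 1) - z k) := by abel
  have := crossing_square (hz m) (hz k) (hpar k m) (sub_ne_zero.2 h0.symm)
    (a2 ▸ sub_ne_zero.2 h1.symm) (a1 ▸ sub_ne_zero.2 h2.symm) (a3 ▸ sub_ne_zero.2 h3.symm)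
  rwa [← a3, ← a1, ← a2] at this

/-- Closedness summed over a column of unit squares of secants. -/
lemma sum_crossing_column (hz : ∀ i, IsDiag (z (i + 1) - z i))
    (hpar : ∀ i j, Even ((z j - z i).1 + (z j - z i).2)) {l k m : ℕ} (hlk : l ≤ k)
    (hne : ∀ i, l ≤ i → i ≤ k → z i ≠ z m ∧ z i ≠ z (m + 1)) :
    ∑ i ∈ Finset.Ico l k, crossing (z m - z i) (z m - z (i + 1)) +
        crossing (z m - z k) (z (m + 1) - z k) =
      crossing (z m - z l) (z (m + 1) - z l) +
        ∑ i ∈ Finset.Ico l k, crossing (z (m + 1) - z i) (z (m + 1) - z (i + 1)) := by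
  induction k, hlk using Nat.le_induction with
  | base => simp
  | succ k hk ih =>
    have ih' := ih fun i h h' => hne i h (by omega)
    rw [Finset.sum_Ico_succ_top hk, Finset.sum_Ico_succ_top hk]
    have := crossing_square_secant hz hpar (hne k hk (by omega)).1 (hne k hk (by omega)).2
      (hne (k + 1) (by omega) le_rfl).1 (hne (k + 1) (by omega) le_rfl).2
    linarith

/-- The rotation of the tangent from time `0` to time `k` is the rotation of the secant along the
two legs of the triangle of pairs of times. -/
lemma sum_turnCrossing_triangle (hz : ∀ i, IsDiag (z (i + 1) - z i))
    (hpar : ∀ i j, Even ((z j - z i).1 + (z j - z i).2)) (k : ℕ)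
    (hne : ∀ i j, i < j → j ≤ k + 1 → z i ≠ z j) :
    ∑ i ∈ Finset.Ico 0 k, turnCrossing (z (i + 1) - z i) (z (i + 2) - z (i + 1)) =
      ∑ j ∈ Finset.Ico 0 k, crossing (z (j + 1) - z 0) (z (j + 2) - z 0) +
        ∑ i ∈ Finset.Ico 0 k, crossing (z (k + 1) - z i) (z (k + 1) - z (i + 1)) := by
  induction k with
  | zero => simp
  | succ k ih =>
    have ih' := ih fun i j h h' => hne i j h (by omega)
    have := sum_crossing_column hz hpar (Nat.zero_le k) (m := k + 1)
      fun i _ h => ⟨hne _ _ (by omega) (by omega), hne _ _ (by omega) (by omega)⟩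
    simp only [Finset.sum_Ico_succ_top (Nat.zero_le _)]
    rw [ih', turnCrossing]
    have e : z (k + 1) - z k + (z (k + 2) - z (k + 1)) = z (k + 2) - z k := by abel
    rw [e]
    simp only [add_assoc, Nat.reduceAdd] at this ⊢
    linarith

lemma crossing_eq_zero_of_nonneg {w w' : ℤ × ℤ} (h : 0 ≤ w.2) (h' : 0 ≤ w'.2) :
    crossing w w' = 0 := by
  simp [crossing, h, h']

/-- In the closed lower half-plane without the origin, `crossing` is the differential of the
indicator of the positive horizontal axis. -/
lemma crossing_of_nonpos {w e : ℤ × ℤ} (he : IsDiag e) (hw : Even (w.1 + w.2))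
    (h0 : w ≠ 0) (h1 : w + e ≠ 0) (h : w.2 ≤ 0) (h' : (w + e).2 ≤ 0) :
    crossing w (w + e) =
      (if 0 ≤ (w + e).2 ∧ 0 < (w + e).1 then 1 else 0) - (if 0 ≤ w.2 ∧ 0 < w.1 then 1 else 0) := by
  obtain ⟨x, y⟩ := w
  obtain ⟨a, b⟩ := e
  obtain ⟨k, hk⟩ := hw
  simp only [IsDiag, crossing, Prod.mk_add_mk, ne_eq, Prod.mk_eq_zero, not_and] at *
  rcases he with ⟨rfl | rfl, rfl | rfl⟩ <;> split_ifs <;> omega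

lemma IsDiag.neg {e : ℤ × ℤ} (he : IsDiag e) : IsDiag (-e) := by
  simp only [IsDiag, Prod.fst_neg, Prod.snd_neg] at *
  omega

/-- The contribution of a lowest point `p₀` of a polygon, with `p₂` before and `p₁` after it, to the
rotation number: the turn of the secants from `p₂ - p₀` to `p₀ - p₁`, the rotation in the lower
half-plane from `p₀ - p₁` to `p₀ - p₂`, and the turn of the tangent at `p₀`. The directions at `p₀` are
`(a, -1)` and `(a, 1)`, and exactly one crossing, of sign `a`, results. -/
lemma crossing_corner_ne {p₀ p₁ p₂ : ℤ × ℤ} (h₁ : IsDiag (p₁ - p₀)) (h₂ : IsDiag (p₀ - p₂))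
    (l₁ : p₀.2 ≤ p₁.2) (l₂ : p₀.2 ≤ p₂.2) (hne : p₁ ≠ p₂) :
    crossing (p₂ - p₀) (p₂ - p₁) + crossing (p₂ - p₁) (p₀ - p₁) +
      ((if 0 ≤ (p₀ - p₂).2 ∧ 0 < (p₀ - p₂).1 then 1 else 0) -
        (if 0 ≤ (p₀ - p₁).2 ∧ 0 < (p₀ - p₁).1 then 1 else 0)) +
      (crossing (p₀ - p₂) (p₁ - p₂) + crossing (p₁ - p₂) (p₁ - p₀)) ≠ 0 := by
  obtain ⟨x, y⟩ := p₀
  obtain ⟨a, b, rfl⟩ : ∃ a b, p₁ = (x + a, y + b) := ⟨p₁.1 - x, p₁.2 - y, by simp⟩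
  obtain ⟨c, d, rfl⟩ : ∃ c d, p₂ = (x + c, y + d) := ⟨p₂.1 - x, p₂.2 - y, by simp⟩
  simp only [IsDiag, crossing, Prod.mk_sub_mk, ne_eq, Prod.mk.injEq, add_right_inj,
    add_sub_cancel_left, sub_add_cancel_left, add_sub_add_left_eq_sub] at *
  obtain ⟨ha, hb⟩ := h₁
  obtain ⟨hc, hd⟩ := h₂
  obtain rfl : b = 1 := by omega
  obtain rfl : d = 1 := by omega
  rcases ha with rfl | rfl
  · obtain rfl : c = 1 := by omega
    simp
  · obtain rfl : c = -1 := by omega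
    simp

/-- Discrete Hopf Umlaufsatz: the tangent of a simple closed diagonal polygon, based at a lowest
point, has nonzero rotation number. The secants from the lowest point lie in a half-plane, so that
only `crossing_corner_ne` contributes. -/
lemma sum_turnCrossing_ne_zero (hz : ∀ i, IsDiag (z (i + 1) - z i))
    (hpar : ∀ i j, Even ((z j - z i).1 + (z j - z i).2)) {n : ℕ}
    (hper : ∀ i, z (i + (n + 3)) = z i)
    (hne : ∀ i j, i < j → j < i + (n + 3) → z i ≠ z j)
    (hlow : ∀ i, (z 0).2 ≤ (z i).2) :
    ∑ i ∈ Finset.range (n + 3), turnCrossing (z (i + 1) - z i) (z (i + 2) - z (i + 1)) ≠ 0 := by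
  have hp0 : z (n + 3) = z 0 := by simpa using hper 0
  have hp1 : z (n + 4) = z 1 := by
    simpa [show 1 + (n + 3) = n + 4 by omega] using hper 1
  have tri := sum_turnCrossing_triangle hz hpar (n + 1) fun i j h h' => hne i j h (by omega)
  have col := sum_crossing_column hz hpar (l := 1) (k := n + 1) (m := n + 2) (by omega)
    fun i h h' => ⟨hne _ _ (by omega) (by omega), hne _ _ (by omega) (by omega)⟩
  have row : ∑ j ∈ Finset.Ico 0 (n + 1), crossing (z (j + 1) - z 0) (z (j + 2) - z 0) = 0 :=
    Finset.sum_eq_zero fun j _ => crossing_eq_zero_of_nonneg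
      (by simpa using hlow _) (by simpa using hlow _)
  have low : ∑ i ∈ Finset.Ico 1 (n + 2), crossing (z (n + 3) - z i) (z (n + 3) - z (i + 1)) =
      (if 0 ≤ (z (n + 3) - z (n + 2)).2 ∧ 0 < (z (n + 3) - z (n + 2)).1 then 1 else 0) -
      (if 0 ≤ (z (n + 3) - z 1).2 ∧ 0 < (z (n + 3) - z 1).1 then 1 else 0) := by
    rw [← Finset.sum_Ico_sub (fun i => if 0 ≤ (z (n + 3) - z i).2 ∧ 0 < (z (n + 3) - z i).1
      then (1 : ℤ) else 0) (by omega : 1 ≤ n + 2)]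
    refine Finset.sum_congr rfl fun i hi => ?_
    have hi := Finset.mem_Ico.1 hi
    have e : z (n + 3) - z (i + 1) = z (n + 3) - z i + -(z (i + 1) - z i) := by abel
    have e1 : (z (n + 3) - z i) ≠ 0 := sub_ne_zero.2 (hne _ _ (by omega) (by omega)).symm
    have e2 : (z (n + 3) - z (i + 1)) ≠ 0 := sub_ne_zero.2 (hne _ _ (by omega) (by omega)).symm
    have e3 : (z (n + 3) - z i).2 ≤ 0 := by simpa [hp0] using hlow i
    have e4 : (z (n + 3) - z (i + 1)).2 ≤ 0 := by simpa [hp0] using hlow (i + 1)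
    rw [e] at e2 e4 ⊢
    exact crossing_of_nonpos (hz i).neg (hpar _ _) e1 e2 e3 e4
  rw [Finset.sum_range_succ, Finset.sum_range_succ]
  rw [Finset.range_eq_Ico, tri, row, Finset.sum_eq_sum_Ico_succ_bot (by omega)]
  rw [Finset.sum_Ico_succ_top (by omega)] at low
  simp only [turnCrossing, add_assoc, Nat.reduceAdd, zero_add] at *
  have s1 : z (n + 2) - z (n + 1) + (z (n + 3) - z (n + 2)) = z (n + 3) - z (n + 1) := by abel
  have s2 : z (n + 3) - z (n + 2) + (z (n + 4) - z (n + 3)) = z (n + 4) - z (n + 2) := by abel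
  rw [s1, s2]
  have t0 := hz 0
  have t1 := hz (n + 2)
  have l1 := hlow 1
  have l2 := hlow (n + 2)
  have nn := hne 1 (n + 2) (by omega) (by omega)
  simp only [add_assoc, Nat.reduceAdd, zero_add] at t0 t1
  rw [hp0, hp1] at *
  generalize ∑ i ∈ Finset.Ico 1 (n + 1), crossing (z (n + 2) - z i) (z (n + 2) - z (i + 1)) = A at *
  generalize ∑ i ∈ Finset.Ico 1 (n + 1), crossing (z 0 - z i) (z 0 - z (i + 1)) = B at *
  generalize crossing (z (n + 2) - z (n + 1)) (z 0 - z (n + 1)) = C at *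
  generalize crossing (z 0 - z (n + 1)) (z 0 - z (n + 2)) = D at *
  have := crossing_corner_ne t0 t1 l1 l2 nn
  omega

end Secants

/-! ### Cycles of the walk -/

lemma exists_antidifference (g : ℤ → ℤ) : ∃ F : ℤ → ℤ, ∀ y, F (y + 1) - F y = g y := by
  refine ⟨fun y => ∑ k ∈ Finset.range y.toNat, g k -
    ∑ k ∈ Finset.range (-y).toNat, g (-1 - k), fun y => ?_⟩
  rcases lt_or_ge y 0 with h | h
  · have h1 : (y + 1).toNat = 0 := by omega
    have h2 : y.toNat = 0 := by omega
    have h3 : (-y).toNat = (-(y + 1)).toNat + 1 := by omega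
    have h4 : -1 - (((-(y + 1)).toNat : ℕ) : ℤ) = y := by omega
    simp only [h1, h2, h3, Finset.sum_range_succ, h4]
    ring
  · have h1 : (y + 1).toNat = y.toNat + 1 := by omega
    have h2 : (-y).toNat = 0 := by omega
    have h3 : (-(y + 1)).toNat = 0 := by omega
    have h4 : ((y.toNat : ℕ) : ℤ) = y := by omega
    simp only [h1, h2, h3, Finset.sum_range_succ, h4]
    ring

/-- The crossing number is a quarter of the number of quarter turns (half the cross product of the
two directions), up to a boundary term that depends on the quadrants of the directions. -/
lemma eight_mul_turnCrossing : ∃ q : ℤ × ℤ → ℤ, ∀ e e' : ℤ × ℤ, IsDiag e → IsDiag e' → e + e' ≠ 0 →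
    8 * turnCrossing e e' = (e.1 * e'.2 - e.2 * e'.1) + 2 * (q e - q e') := by
  -- `q` numbers the quadrants counterclockwise, starting from the reference half-line.
  refine ⟨fun e => if 0 < e.2 then (if 0 < e.1 then 0 else 1) else (if 0 < e.1 then 3 else 2), ?_⟩
  rintro ⟨a, b⟩ ⟨c, d⟩ ⟨ha, hb⟩ ⟨hc, hd⟩ h
  simp only at ha hb hc hd
  rcases ha with rfl | rfl <;> rcases hb with rfl | rfl <;> rcases hc with rfl | rfl <;>
    rcases hd with rfl | rfl <;> simp [turnCrossing, crossing] at h ⊢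

lemma step_sub (u v : ℤ → ℤ) (p : ℤ × ℤ) : step u v p - p = (u p.2, v p.1) := by
  ext <;> simp [step]

section Cycles

variable {u v : ℤ → ℤ} (hu : ∀ y, u y = -1 ∨ u y = 1) (hv : ∀ x, v x = -1 ∨ v x = 1)
include hu hv

/-- With potentials `A`, `B` whose increments are `u y + u (y + 1)` and `v x + v (x + 1)`, the quantity
`A y - B x` changes along a step by the amount of turning, so that a closed path has no turning in
total. -/
lemma sum_turning_eq_zero {p : ℤ × ℤ} {n : ℕ} (hp : (step u v)^[n] p = p) :
    ∑ i ∈ Finset.range n, (u ((step u v)^[i] p).2 * v ((step u v)^[i + 1] p).1 -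
      v ((step u v)^[i] p).1 * u ((step u v)^[i + 1] p).2) = 0 := by
  obtain ⟨A, hA⟩ := exists_antidifference fun y => u y + u (y + 1)
  obtain ⟨B, hB⟩ := exists_antidifference fun x => v x + v (x + 1)
  have key : ∀ q : ℤ × ℤ, u q.2 * v (step u v q).1 - v q.1 * u (step u v q).2 =
      (B (step u v q).1 - A (step u v q).2) - (B q.1 - A q.2) := by
    rintro ⟨x, y⟩
    simp only [step]
    have h1 := hA y
    have h2 := hA (y - 1)
    have h3 := hB x
    have h4 := hB (x - 1)
    simp only [sub_add_cancel] at h2 h4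
    rcases hu y with h | h <;> rcases hv x with h' | h' <;>
      simp only [h, h', ← sub_eq_add_neg] at * <;> linarith
  simp only [Function.iterate_succ_apply', key]
  simp only [← Function.iterate_succ_apply']
  rw [Finset.sum_range_sub (fun i => B ((step u v)^[i] p).1 - A ((step u v)^[i] p).2) n, hp]
  simp

lemma isDiag_step (p : ℤ × ℤ) : IsDiag (step u v p - p) := by
  rw [step_sub]
  exact ⟨hu _, hv _⟩

/-- The only cycles of the walk are the traps. -/
theorem step_step_eq_of_periodic {p : ℤ × ℤ} {n : ℕ} (hn : 0 < n) (hp : (step u v)^[n] p = p) :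
    step u v (step u v p) = p := by
  set f := step u v with hf
  -- Move to a lowest point of the orbit.
  obtain ⟨m, -, hm⟩ := Finset.exists_min_image (Finset.range n) (fun i => (f^[i] p).2)
    ⟨0, Finset.mem_range.2 hn⟩
  have hmod : ∀ i, f^[i] p = f^[i % n] p := fun i =>
    ((show Function.IsPeriodicPt f n p from hp).iterate_mod_apply i).symm
  have hlow : ∀ i, (f^[m] p).2 ≤ (f^[i] p).2 := fun i => by
    rw [hmod i]
    exact hm _ (Finset.mem_range.2 (Nat.mod_lt _ hn))
  set q := f^[m] p with hq
  have hqn : Function.IsPeriodicPt f n q :=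
    (show Function.IsPeriodicPt f n p from hp).apply_iterate m
  suffices h : f (f q) = q by
    have h2 : ∀ i, f (f (f^[i] q)) = f^[i] q := fun i => by
      rw [← Function.iterate_succ_apply' f, ← Function.iterate_succ_apply' f,
        Function.iterate_succ_apply, Function.iterate_succ_apply, h]
    obtain ⟨i, hi⟩ : ∃ i, f^[i] q = p := by
      refine ⟨n * m - m, ?_⟩
      rw [hq, ← Function.iterate_add_apply, Nat.sub_add_cancel (Nat.le_mul_of_pos_left m hn)]
      exact (show Function.IsPeriodicPt f n p from hp).mul_const m
    rw [← hi]
    exact h2 i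
  by_contra hne
  have hlow' : ∀ i, q.2 ≤ (f^[i] q).2 := fun i => by
    rw [hq, ← Function.iterate_add_apply]
    exact hlow _
  set N := Function.minimalPeriod f q with hN
  have hN0 : 0 < N := hqn.minimalPeriod_pos hn
  have hfix : f^[N] q = q := Function.isPeriodicPt_minimalPeriod f q
  have hN1 : N ≠ 1 := fun h => by
    have h1 : f q = q := by rw [h] at hfix; exact hfix
    exact hne (by rw [h1, h1])
  have hN2 : N ≠ 2 := fun h => by rw [h] at hfix; exact hne hfix
  obtain ⟨k, hk⟩ : ∃ k, N = k + 3 := ⟨N - 3, by omega⟩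
  have hz : ∀ i, IsDiag (f^[i + 1] q - f^[i] q) := fun i => by
    rw [Function.iterate_succ_apply']
    exact isDiag_step hu hv _
  have hpar0 : ∀ i, Even ((f^[i] q - q).1 + (f^[i] q - q).2) := fun i => by
    induction i with
    | zero => simp
    | succ i ih =>
      have := hz i
      simp only [IsDiag, Prod.fst_sub, Prod.snd_sub, Int.even_iff] at this ih ⊢
      omega
  have hpar : ∀ i j, Even ((f^[j] q - f^[i] q).1 + (f^[j] q - f^[i] q).2) := fun i j => by
    have h1 := hpar0 i
    have h2 := hpar0 j
    simp only [Prod.fst_sub, Prod.snd_sub, Int.even_iff] at h1 h2 ⊢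
    omega
  have hper : ∀ i, f^[i + (k + 3)] q = f^[i] q := fun i => by
    rw [← hk, Function.iterate_add_apply, hfix]
  have hinj : ∀ i j, i < j → j < i + (k + 3) → f^[i] q ≠ f^[j] q := fun i j hij hj h => by
    have hper' : Function.IsPeriodicPt f (j - i) (f^[i] q) := by
      rw [Function.IsPeriodicPt, Function.IsFixedPt, ← Function.iterate_add_apply,
        Nat.sub_add_cancel hij.le, h]
    have h1 := hper'.minimalPeriod_le (by omega)
    rw [Function.minimalPeriod_apply_iterate (Function.mk_mem_periodicPts hn hqn)] at h1
    omega
  have hturn : ∀ i, f^[i + 1] q - f^[i] q + (f^[i + 2] q - f^[i + 1] q) ≠ 0 := fun i => by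
    have : f^[i + 1] q - f^[i] q + (f^[i + 2] q - f^[i + 1] q) = f^[i + 2] q - f^[i] q := by abel
    rw [this]
    exact sub_ne_zero.2 (hinj i (i + 2) (by omega) (by omega)).symm
  refine sum_turnCrossing_ne_zero hz hpar hper hinj hlow' ?_
  obtain ⟨Q, hQ⟩ := eight_mul_turnCrossing
  have h0 := sum_turning_eq_zero hu hv hfix
  have hsum : 8 * ∑ i ∈ Finset.range (k + 3),
      turnCrossing (f^[i + 1] q - f^[i] q) (f^[i + 2] q - f^[i + 1] q) = 0 := by
    rw [Finset.mul_sum, Finset.sum_congr rfl fun i _ => hQ _ _ (hz i) (hz (i + 1)) (hturn i),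
      Finset.sum_add_distrib, ← Finset.mul_sum,
      Finset.sum_range_sub' (fun i => Q (f^[i + 1] q - f^[i] q))]
    have e0 : f^[k + 3 + 1] q - f^[k + 3] q = f^[0 + 1] q - f^[0] q := by
      have a := hper 0
      have b := hper 1
      rw [zero_add] at a
      rw [a, show k + 3 + 1 = 1 + (k + 3) by omega, b]
    rw [e0, sub_self, mul_zero, add_zero, ← h0, hk]
    refine Finset.sum_congr rfl fun i _ => ?_
    have e1 : ∀ i, f^[i + 1] q - f^[i] q = (u (f^[i] q).2, v (f^[i] q).1) := fun i => by
      rw [Function.iterate_succ_apply']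
      exact step_sub u v _
    rw [e1 i, show i + 1 + 1 = (i + 1) + 1 from rfl, e1 (i + 1)]
  omega

end Cycles

/-! ### Components of the graph -/

/-- The vertices whose forward path reaches `q`, where `q` is the lower endpoint of a trap; empty if
`q` is not of this kind. The endpoint with upward direction is chosen so that each trap is counted
once. -/
def basin (u v : ℤ → ℤ) (q : ℤ × ℤ) : Set (ℤ × ℤ) :=
  {p | ∃ n, (step u v)^[n] p = q ∧ step u v (step u v q) = q ∧ v q.1 = 1}

lemma mem_omega {u v : ℤ → ℤ} {a b : ℤ × ℤ} : (a, b) ∈ omega u v ↔ b = step u v a := by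
  obtain ⟨x, y⟩ := a
  simp only [omega, step, Set.mem_ofPred_eq, Prod.mk.injEq]
  constructor
  · rintro ⟨_, _, ⟨rfl, rfl⟩, h⟩
    exact h
  · intro h
    exact ⟨x, y, ⟨rfl, rfl⟩, h⟩

lemma graph_omega_adj {u v : ℤ → ℤ} {a b : ℤ × ℤ} :
    (graph (omega u v)).Adj a b ↔ a ≠ b ∧ (b = step u v a ∨ a = step u v b) := by
  simp [graph, mem_omega]

/-- After `n` steps from a trap the walk is at one of its two endpoints. -/
lemma iterate_mem_of_step_step_eq {α : Type*} {f : α → α} {q : α} (hq : f (f q) = q) (n : ℕ) :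
    f^[n] q = q ∨ f^[n] q = f q := by
  induction n with
  | zero => simp
  | succ n ih =>
    rw [Function.iterate_succ_apply']
    rcases ih with h | h <;> simp [h, hq]

lemma reflTransGen_iterate (u v : ℤ → ℤ) (p : ℤ × ℤ) (n : ℕ) :
    Relation.ReflTransGen (fun a b => (a, b) ∈ omega u v) p ((step u v)^[n] p) := by
  induction n with
  | zero => exact .refl
  | succ n ih =>
    rw [Function.iterate_succ_apply']
    exact ih.tail (mem_omega.2 rfl)

section

variable {u v : ℤ → ℤ} {p q q' : ℤ × ℤ}

lemma step_mem_basin_iff : step u v p ∈ basin u v q ↔ p ∈ basin u v q := by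
  constructor
  · rintro ⟨n, hn, h⟩
    exact ⟨n + 1, hn, h⟩
  · rintro ⟨n, hn, h, h'⟩
    cases n with
    | zero => exact ⟨1, by obtain rfl : p = q := hn; exact h, h, h'⟩
    | succ n => exact ⟨n, hn, h, h'⟩

lemma iterate_mem_basin_iff (n : ℕ) : (step u v)^[n] p ∈ basin u v q ↔ p ∈ basin u v q := by
  induction n with
  | zero => rfl
  | succ n ih => rw [Function.iterate_succ_apply', step_mem_basin_iff, ih]

lemma mem_basin_self (h : step u v (step u v q) = q) (hv : v q.1 = 1) : q ∈ basin u v q :=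
  ⟨0, rfl, h, hv⟩

/-- Two upward endpoints of traps that lie on a common forward path coincide. -/
lemma basin_unique (h : p ∈ basin u v q) (h' : p ∈ basin u v q') : q = q' := by
  obtain ⟨n, hn, hq, hvq⟩ := h
  have h2 := (iterate_mem_basin_iff n).2 h'
  rw [hn] at h2
  obtain ⟨m, hm, hq', hvq'⟩ := h2
  rcases iterate_mem_of_step_step_eq hq m with h | h
  · rw [← hm, h]
  · rw [hm] at h
    rw [h] at hvq'
    have := congrArg Prod.snd hq
    simp only [step] at this hvq'
    omega

section Signs

variable (hu : ∀ y, u y = -1 ∨ u y = 1) (hv : ∀ x, v x = -1 ∨ v x = 1)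

include hu in
lemma step_ne (p : ℤ × ℤ) : step u v p ≠ p := by
  intro h
  have := congrArg Prod.fst h
  simp only [step] at this
  have := hu p.2
  omega

include hv in
/-- One of the two endpoints of a trap has upward direction. -/
lemma exists_mem_basin_of_step_step_eq (h : step u v (step u v q) = q) :
    q ∈ basin u v q ∨ q ∈ basin u v (step u v q) := by
  rcases hv q.1 with h1 | h1
  · right
    refine ⟨1, rfl, congrArg _ h, ?_⟩
    have := congrArg Prod.snd h
    have := hv (step u v q).1
    simp only [step] at *
    omega
  · exact Or.inl (mem_basin_self h h1)

include hu hv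

/-- A walk with bounded path ends in a trap. -/
lemma exists_mem_basin (hfin : (Set.range fun n => (step u v)^[n] p).Finite) :
    ∃ q, p ∈ basin u v q := by
  obtain ⟨m, n, hmn, h⟩ : ∃ m n, m < n ∧ (step u v)^[m] p = (step u v)^[n] p := by
    by_contra! hne
    refine Set.infinite_range_of_injective (f := fun n => (step u v)^[n] p) ?_ hfin
    intro m n h
    rcases lt_trichotomy m n with h' | h' | h'
    · exact absurd h (hne _ _ h')
    · exact h'
    · exact absurd h.symm (hne _ _ h')
  have hper : (step u v)^[n - m] ((step u v)^[m] p) = (step u v)^[m] p := by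
    rw [← Function.iterate_add_apply, Nat.sub_add_cancel hmn.le, h]
  have h2 := step_step_eq_of_periodic hu hv (by omega) hper
  rcases exists_mem_basin_of_step_step_eq hv h2 with h3 | h3
  · exact ⟨_, (iterate_mem_basin_iff m).1 h3⟩
  · exact ⟨_, (iterate_mem_basin_iff m).1 h3⟩

omit hv in
lemma reachable_iterate (n : ℕ) :
    (graph (omega u v)).Reachable p ((step u v)^[n] p) := by
  induction n with
  | zero => rfl
  | succ n ih =>
    rw [Function.iterate_succ_apply']
    exact ih.trans (graph_omega_adj.2 ⟨(step_ne hu _).symm, Or.inl rfl⟩).reachable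

omit hu hv in
lemma mem_basin_of_reachable (h : (graph (omega u v)).Reachable p q') (hp : p ∈ basin u v q) :
    q' ∈ basin u v q := by
  obtain ⟨w⟩ := h
  induction w with
  | nil => exact hp
  | cons hadj _ ih =>
    apply ih
    rcases (graph_omega_adj.1 hadj).2 with h | h
    · rw [h, step_mem_basin_iff]
      exact hp
    · rw [h, step_mem_basin_iff] at hp
      exact hp

omit hv in
/-- The connected components are the basins. -/
lemma supp_eq_basin {C : (graph (omega u v)).ConnectedComponent} (hp : p ∈ C.supp)
    (hpq : p ∈ basin u v q) : C.supp = basin u v q := by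
  have hC : (graph (omega u v)).connectedComponentMk p = C := hp
  have hq : (graph (omega u v)).Reachable p q := by
    obtain ⟨n, hn, -⟩ := hpq
    rw [← hn]
    exact reachable_iterate hu n
  ext r
  rw [SimpleGraph.ConnectedComponent.mem_supp_iff, ← hC, SimpleGraph.ConnectedComponent.eq]
  refine ⟨fun h => mem_basin_of_reachable h.symm hpq, ?_⟩
  rintro ⟨n, hn, -⟩
  have h := reachable_iterate (v := v) hu (p := r) n
  rw [hn] at h
  exact h.trans hq.symm

omit hv in
/-- A finite component is a tree: sending each vertex to its outgoing edge covers all edges, even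
without the root, since the root shares its edge with the other endpoint of the trap. -/
lemma isTree_toSimpleGraph {C : (graph (omega u v)).ConnectedComponent} (hq : q ∈ C.supp)
    (hqq : step u v (step u v q) = q) (hfin : C.supp.Finite) : C.toSimpleGraph.IsTree := by
  have : Finite C := hfin
  have hconn := C.connected_toSimpleGraph
  have hmem : ∀ p ∈ C.supp, step u v p ∈ C.supp := fun p hp =>
    (SimpleGraph.ConnectedComponent.mem_supp_congr_adj C
      (graph_omega_adj.2 ⟨(step_ne hu p).symm, Or.inl rfl⟩)).1 hp
  rw [SimpleGraph.isTree_iff_connected_and_card]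
  refine ⟨hconn, le_antisymm ?_ hconn.card_vert_le_card_edgeSet_add_one⟩
  let g : {p : C // p ≠ ⟨q, hq⟩} → Sym2 C := fun p => s(p.1, ⟨step u v p.1, hmem _ p.1.2⟩)
  have hsub : C.toSimpleGraph.edgeSet ⊆ Set.range g := by
    have key : ∀ a b : C, (b : ℤ × ℤ) = step u v a → s(a, b) ∈ Set.range g := by
      rintro a b hab
      by_cases haq : a = ⟨q, hq⟩
      · refine ⟨⟨b, ?_⟩, ?_⟩
        · rintro rfl
          rw [haq] at hab
          exact step_ne hu q hab.symm
        · have : (⟨step u v b, hmem _ b.2⟩ : C) = a := by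
            apply Subtype.ext
            simp [hab, haq, hqq]
          simp only [g, this]
          exact Sym2.eq_swap
      · refine ⟨⟨a, haq⟩, ?_⟩
        have : (⟨step u v a, hmem _ a.2⟩ : C) = b := Subtype.ext hab.symm
        simp only [g, this]
    intro e
    induction e using Sym2.ind with
    | _ a b =>
      intro hab
      have hab' : (graph (omega u v)).Adj a b := hab
      rcases (graph_omega_adj.1 hab').2 with h | h
      · exact key a b h
      · rw [Sym2.eq_swap]
        exact key b a h
  have h1 : Nat.card C.toSimpleGraph.edgeSet ≤ Nat.card {p : C // p ≠ ⟨q, hq⟩} :=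
    (Nat.card_mono (Set.finite_range g) hsub).trans (Finite.card_range_le g)
  have h2 : Nat.card {p : C // p ≠ ⟨q, hq⟩} < Nat.card C :=
    Finite.card_subtype_lt (x := ⟨q, hq⟩) (by simp)
  omega

/-- If all forward paths are bounded and all basins are finite, the components are finite trees
rooted at traps. -/
theorem components_of_finite (horbit : ∀ p, (Set.range fun n => (step u v)^[n] p).Finite)
    (hbasin : ∀ q, (basin u v q).Finite) :
    (∀ C : (graph (omega u v)).ConnectedComponent,
        Bornology.IsBounded C.supp ∧
        (∃! t : Sym2 (ℤ × ℤ), IsTrap (omega u v) t ∧ Contains C t)) ∧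
      (∀ C : (graph (omega u v)).ConnectedComponent,
        ∃ t : Sym2 (ℤ × ℤ), IsTrap (omega u v) t ∧ IsFiniteTreeRootedAt C t) ∧
      ¬ ∃ a : ℕ → ℤ × ℤ, IsPathFromInfinity (omega u v) a := by
  have hroot : ∀ C : (graph (omega u v)).ConnectedComponent, ∃ q, C.supp = basin u v q ∧
      q ∈ basin u v q ∧ step u v q ∈ basin u v q ∧ step u v (step u v q) = q := fun C => by
    obtain ⟨p, hp⟩ := C.nonempty_supp
    obtain ⟨q, hpq⟩ := exists_mem_basin hu hv (horbit p)
    obtain ⟨n, hn, hqq, hvq⟩ := id hpq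
    have hq := mem_basin_self hqq hvq
    exact ⟨q, supp_eq_basin hu hp hpq, hq, step_mem_basin_iff.2 hq, hqq⟩
  have hmain : ∀ C : (graph (omega u v)).ConnectedComponent, C.supp.Finite ∧
      ∃ t : Sym2 (ℤ × ℤ), IsTrap (omega u v) t ∧ IsFiniteTreeRootedAt C t ∧
        ∀ t', IsTrap (omega u v) t' → Contains C t' → t' = t := fun C => by
    obtain ⟨q, hC, hq, hfq, hqq⟩ := hroot C
    have hfin : C.supp.Finite := hC ▸ hbasin q
    refine ⟨hfin, s(q, step u v q), ⟨_, _, rfl, mem_omega.2 rfl, mem_omega.2 hqq.symm⟩,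
      ⟨hfin, isTree_toSimpleGraph hu (hC ▸ hq) hqq hfin, ?_, ?_⟩, ?_⟩
    · intro p hp
      rcases Sym2.mem_iff.1 hp with rfl | rfl
      · rwa [hC]
      · rwa [hC]
    · intro p hp r hr
      rw [hC] at hp
      obtain ⟨n, hn, -⟩ := hp
      have h := reflTransGen_iterate u v p n
      rw [hn] at h
      rcases Sym2.mem_iff.1 hr with rfl | rfl
      · exact h
      · exact h.tail (mem_omega.2 rfl)
    · rintro _ ⟨a, b, rfl, hab, hba⟩ ht
      rw [mem_omega] at hab hba
      have ha : a ∈ basin u v q := hC ▸ ht a (Sym2.mem_mk_left a b)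
      have haa : step u v (step u v a) = a := by rw [← hab, ← hba]
      rcases exists_mem_basin_of_step_step_eq hv haa with h | h
      · rw [basin_unique ha h, ← hab]
      · rw [basin_unique ha h, haa, ← hab]
        exact Sym2.eq_swap
  refine ⟨fun C => ?_, fun C => ?_, ?_⟩
  · obtain ⟨hfin, t, ht, ht', huniq⟩ := hmain C
    exact ⟨hfin.isBounded, t, ⟨ht, ht'.2.2.1⟩, fun t' h => huniq t' h.1 h.2⟩
  · obtain ⟨-, t, ht, ht', -⟩ := hmain C
    exact ⟨t, ht, ht'⟩
  · rintro ⟨a, hinj, ha⟩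
    obtain ⟨q, hq⟩ := exists_mem_basin hu hv (horbit (a 0))
    have hall : ∀ n, a n ∈ basin u v q := fun n => by
      induction n with
      | zero => exact hq
      | succ n ih => rwa [mem_omega.1 (ha n), step_mem_basin_iff] at ih
    exact Set.infinite_range_of_injective hinj
      ((hbasin q).subset (Set.range_subset_iff.2 hall))

end Signs

end

/-! ### Walks unbounded above -/

/-- The walk from `p` arrives in row `M` for the first time in a column with downward
orientation. -/
def IsPeak (u v : ℤ → ℤ) (p : ℤ × ℤ) (M : ℤ) : Prop :=
  ∃ n, ((step u v)^[n] p).2 = M ∧ (∀ m < n, ((step u v)^[m] p).2 < M) ∧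
    v ((step u v)^[n] p).1 = -1

/-- `M` is the highest row visited by the walk from `p`. -/
def IsTopRow (u v : ℤ → ℤ) (p : ℤ × ℤ) (M : ℤ) : Prop :=
  (∃ n, ((step u v)^[n] p).2 = M) ∧ ∀ n, ((step u v)^[n] p).2 ≤ M

lemma IsTopRow.unique {u v : ℤ → ℤ} {p : ℤ × ℤ} {M M' : ℤ} (h : IsTopRow u v p M)
    (h' : IsTopRow u v p M') : M = M' := by
  obtain ⟨⟨n, hn⟩, hle⟩ := h
  obtain ⟨⟨n', hn'⟩, hle'⟩ := h'
  exact le_antisymm (hn ▸ hle' n) (hn' ▸ hle n')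

/-- The walk from every vertex stays below some row. -/
def BoundedAbove (u v : ℤ → ℤ) : Prop := ∀ p, ∃ M, ∀ n, ((step u v)^[n] p).2 ≤ M

section

variable {u v : ℤ → ℤ} {p : ℤ × ℤ} {M : ℤ} (hv : ∀ x, v x = -1 ∨ v x = 1)
include hv

/-- Reversing the row of a peak beyond which the walk continues upwards turns the arrival in that row
into a trap. -/
lemma IsPeak.isTopRow_update (hu : ∀ y, u y = -1 ∨ u y = 1) (h : IsPeak u v p M) (hpM : p.2 < M)
    (hub : ¬ ∀ n, ((step u v)^[n] p).2 ≤ M) :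
    IsTopRow (Function.update u M (-u M)) v p M := by
  set u' := Function.update u M (-u M) with hu'
  obtain ⟨n, hn, hlt, hvn⟩ := h
  obtain ⟨k, rfl⟩ : ∃ k, n = k + 1 := by
    cases n with
    | zero => exact absurd hn hpM.ne
    | succ k => exact ⟨k, rfl⟩
  have hstep : ∀ q : ℤ × ℤ, q.2 ≠ M → step u' v q = step u v q := fun q hq => by
    simp [step, hu', Function.update_of_ne hq]
  have hagree : ∀ m ≤ k + 1, (step u' v)^[m] p = (step u v)^[m] p := fun m hm => by
    induction m with
    | zero => rfl
    | succ m ih =>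
      rw [Function.iterate_succ_apply', Function.iterate_succ_apply', ih (by omega)]
      exact hstep _ (hlt m (by omega)).ne
  set q := (step u v)^[k] p with hq
  have hqM : q.2 < M := hlt k (by omega)
  rw [Function.iterate_succ_apply', ← hq] at hn hvn
  have hv1 := hv q.1
  have h1 : v q.1 = 1 := by
    simp only [step] at hn
    omega
  -- The walk arrives in row `M` from `q`; if it arrived against the orientation of the row, it
  -- would be trapped there.
  have hback : ∀ w : ℤ → ℤ, step w v q = step u v q → w M = -u q.2 →
      step w v (step w v q) = q := fun w hw hwM => by
    rw [hw]
    ext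
    · simp only [step] at hn ⊢
      rw [hn, hwM]
      ring
    · rw [step, hn, hvn]
      simp only [step, h1] at hn
      linarith
  have hbound : ∀ w : ℤ → ℤ, step w v q = step u v q → w M = -u q.2 →
      (∀ m ≤ k, (step w v)^[m] p = (step u v)^[m] p) → ∀ m, ((step w v)^[m] p).2 ≤ M := by
    intro w hw hwM hag m
    rcases le_or_gt m k with hm | hm
    · rw [hag m hm]
      exact (hlt m (by omega)).le
    · obtain ⟨j, rfl⟩ : ∃ j, m = j + k := ⟨m - k, by omega⟩
      rw [Function.iterate_add_apply, hag k le_rfl, ← hq]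
      rcases iterate_mem_of_step_step_eq (hback w hw hwM) j with h | h
      · rw [h]
        exact hqM.le
      · rw [h, hw]
        exact hn.le
  have huM : u M = u q.2 := by
    by_contra hne
    have h2 := hu M
    have h3 := hu q.2
    exact hub (hbound u rfl (by omega) fun _ _ => rfl)
  refine ⟨⟨k + 1, ?_⟩, hbound u' (hstep q hqM.ne) (by simp [hu', huM]) fun m hm =>
    hagree m (by omega)⟩
  rw [hagree _ le_rfl, Function.iterate_succ_apply', ← hq, hn]

lemma exists_first_visit (hpM : p.2 ≤ M) (hub : ∃ n, M ≤ ((step u v)^[n] p).2) :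
    ∃ n, ((step u v)^[n] p).2 = M ∧ ∀ m < n, ((step u v)^[m] p).2 < M := by
  classical
  refine ⟨Nat.find hub, ?_, fun m hm => not_le.1 (Nat.find_min hub hm)⟩
  have h1 := Nat.find_spec hub
  rcases h : Nat.find hub with _ | k
  · rw [h] at h1
    exact le_antisymm hpM h1
  · have h2 := Nat.find_min hub (m := k) (by omega)
    rw [h] at h1
    rw [Function.iterate_succ_apply'] at h1 ⊢
    have := hv ((step u v)^[k] p).1
    simp only [step] at h1 h2 ⊢
    omega

/-- A walk unbounded above has arbitrarily high peaks: otherwise it would go straight up, performing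
between two downward columns a walk with steps given by `u`, which is impossible as `u` has long
runs of `1`. -/
lemma exists_isPeak (hu : ∀ y, u y = -1 ∨ u y = 1)
    (hrun : ∀ (L : ℕ) (M₀ : ℤ), ∃ M ≥ M₀, ∀ k : ℕ, k < L → u (M + k) = 1)
    (hright : ∀ x, ∃ r ≥ x, v r = -1) (hleft : ∀ x, ∃ l ≤ x, v l = -1)
    (hub : ∀ M, ∃ n, M ≤ ((step u v)^[n] p).2) (M₀ : ℤ) : ∃ M ≥ M₀, IsPeak u v p M := by
  by_contra! hno
  set M₁ := max M₀ p.2 with hM₁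
  obtain ⟨n, hn, hlt⟩ := exists_first_visit hv (le_max_right M₀ p.2) (hub M₁)
  have hfirst : ∀ k : ℕ, ((step u v)^[n + k] p).2 = M₁ + k ∧
      ∀ m < n + k, ((step u v)^[m] p).2 < M₁ + k := fun k => by
    induction k with
    | zero => simpa using ⟨hn, hlt⟩
    | succ k ih =>
      have h1 : v ((step u v)^[n + k] p).1 = 1 := (hv _).resolve_left fun h =>
        hno (M₁ + k) (by omega) ⟨n + k, ih.1, ih.2, h⟩
      constructor
      · rw [← add_assoc, Function.iterate_succ_apply', step, ih.1, h1]
        push_cast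
        ring
      · intro m hm
        push_cast
        rcases (Nat.lt_succ_iff_lt_or_eq.1 (show m < (n + k).succ from hm)) with h | rfl
        · have := ih.2 m h
          omega
        · have := ih.1
          omega
  have hup : ∀ k : ℕ, v ((step u v)^[n + k] p).1 = 1 := fun k => (hv _).resolve_left fun h =>
    hno (M₁ + k) (by omega) ⟨n + k, (hfirst k).1, (hfirst k).2, h⟩
  have hx : ∀ k : ℕ, ((step u v)^[n + (k + 1)] p).1 = ((step u v)^[n + k] p).1 + u (M₁ + k) :=
    fun k => by rw [← add_assoc, Function.iterate_succ_apply', ← (hfirst k).1, step]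
  obtain ⟨r, hr, hvr⟩ := hright ((step u v)^[n] p).1
  obtain ⟨l, hl, hvl⟩ := hleft ((step u v)^[n] p).1
  have hgap : ∀ k : ℕ, l < ((step u v)^[n + k] p).1 ∧ ((step u v)^[n + k] p).1 < r := fun k => by
    have hne : ∀ s, v s = -1 → ((step u v)^[n + k] p).1 ≠ s := fun s hs h => by
      have := hup k
      rw [h, hs] at this
      omega
    have := hne r hvr
    have := hne l hvl
    induction k with
    | zero =>
      simp only [add_zero] at *
      omega
    | succ k ih =>
      have hne' : ∀ s, v s = -1 → ((step u v)^[n + k] p).1 ≠ s := fun s hs h => by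
        have := hup k
        rw [h, hs] at this
        omega
      have := ih hne' (hne' r hvr) (hne' l hvl)
      have := hx k
      have := hu (M₁ + k)
      omega
  obtain ⟨M, hM, hrunM⟩ := hrun (r - l).toNat M₁
  obtain ⟨j, hj⟩ : ∃ j : ℕ, M = M₁ + j := ⟨(M - M₁).toNat, by omega⟩
  have hclimb : ∀ k : ℕ, k ≤ (r - l).toNat →
      ((step u v)^[n + (j + k)] p).1 = ((step u v)^[n + j] p).1 + k := fun k => by
    induction k with
    | zero => simp
    | succ k ih =>
      intro hk
      have h1 := hx (j + k)
      have h2 := hrunM k (by omega)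
      rw [hj, add_assoc, ← Nat.cast_add] at h2
      rw [h2, ih (by omega)] at h1
      rw [← add_assoc j, h1]
      push_cast
      ring
  have h1 := hclimb _ le_rfl
  have h2 := hgap j
  have h3 := hgap (j + (r - l).toNat)
  omega

end

/-! ### The law of the orientations -/

open scoped ENNReal

/-- The symmetric law on `{-1, 1}`. -/
noncomputable def coin : Measure ℤ := (2⁻¹ : ℝ≥0∞) • Measure.dirac (-1) + (2⁻¹ : ℝ≥0∞) • Measure.dirac 1

instance : IsProbabilityMeasure coin := ⟨by simp [coin, ENNReal.inv_two_add_inv_two]⟩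

lemma coin_singleton {s : ℤ} (hs : s = -1 ∨ s = 1) : coin {s} = 2⁻¹ := by
  rcases hs with rfl | rfl <;> simp [coin]

lemma coin_eq_of_symm {μ : Measure ℤ} [IsProbabilityMeasure μ] (hval : ∀ᵐ s ∂μ, s = -1 ∨ s = 1)
    (hsymm : μ.map (fun s => -s) = μ) : μ = coin := by
  have h1 : μ {-1} = μ {1} := by
    conv_lhs => rw [← hsymm]
    rw [Measure.map_apply (by fun_prop) (measurableSet_singleton _)]
    congr 1
    ext s
    simp
  have h0 : μ {s | s = -1 ∨ s = 1}ᶜ = 0 := hval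
  have h2 : μ {-1} + μ {1} = 1 := by
    rw [← measure_union (by simp) (measurableSet_singleton _)]
    exact (prob_compl_eq_zero_iff (by measurability)).1 h0
  have h3 : μ {1} = 2⁻¹ := by
    rw [h1, ← two_mul] at h2
    exact ENNReal.eq_inv_of_mul_eq_one_left (by rwa [mul_comm])
  refine Measure.ext_of_singleton fun s => ?_
  by_cases hs : s = -1 ∨ s = 1
  · rw [coin_singleton hs]
    rcases hs with rfl | rfl
    · rw [h1, h3]
    · exact h3
  · have h4 : μ {s} = 0 := measure_mono_null (by simpa using hs) h0
    rw [h4]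
    push Not at hs
    simp [coin, Ne.symm hs.1, Ne.symm hs.2]

lemma map_neg_coin : coin.map (fun s => -s) = coin := by
  rw [coin, Measure.map_add _ _ (by fun_prop), Measure.map_smul, Measure.map_smul,
    Measure.map_dirac' (by fun_prop), Measure.map_dirac' (by fun_prop), neg_neg, add_comm]

lemma coin_ae : ∀ᵐ s ∂coin, s = -1 ∨ s = 1 := by
  rw [coin, ae_add_measure_iff]
  constructor <;> refine Measure.ae_smul_measure ?_ _ <;> simp [ae_dirac_eq]

/-- The law of the orientations: independent symmetric signs, where `Sum.inl y` is the index of the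
row `y` and `Sum.inr x` the index of the column `x`. -/
noncomputable def signLaw : Measure (ℤ ⊕ ℤ → ℤ) := Measure.infinitePi fun _ => coin

instance : IsProbabilityMeasure signLaw := by
  unfold signLaw
  infer_instance

/-- The orientations of the rows. -/
def rows (w : ℤ ⊕ ℤ → ℤ) (y : ℤ) : ℤ := w (.inl y)

/-- The orientations of the columns. -/
def cols (w : ℤ ⊕ ℤ → ℤ) (x : ℤ) : ℤ := w (.inr x)

lemma signLaw_ae : ∀ᵐ w ∂signLaw, ∀ i, w i = -1 ∨ w i = 1 :=
  ae_all_iff.2 fun i =>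
    (measurePreserving_eval_infinitePi (fun _ => coin) i).quasiMeasurePreserving.ae coin_ae

/-- Reindexing and sign changes preserve the law of the orientations. -/
lemma measurePreserving_signed (σ : Equiv.Perm (ℤ ⊕ ℤ)) {ε : ℤ ⊕ ℤ → ℤ}
    (hε : ∀ i, ε i = -1 ∨ ε i = 1) :
    MeasurePreserving (fun w i => ε i * w (σ i)) signLaw signLaw := by
  have h1 : MeasurePreserving (fun (w : ℤ ⊕ ℤ → ℤ) i => w (σ i)) signLaw signLaw :=
    ⟨by fun_prop, Measure.map_infinitePi_infinitePi_of_inj σ.injective⟩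
  have h2 : MeasurePreserving (fun (w : ℤ ⊕ ℤ → ℤ) i => ε i * w i) signLaw signLaw := by
    refine ⟨by fun_prop, ?_⟩
    rw [signLaw, Measure.infinitePi_map_pi (f := fun i s => ε i * s) _ fun i => by fun_prop]
    congr 1
    ext1 i
    rcases hε i with h | h
    · simpa [h] using map_neg_coin
    · simp [h]
  exact h2.comp h1

/-! ### Recurring patterns and measurability -/

/-- Any prescribed finite constant pattern along an injective sequence of indices recurs, by the
second Borel–Cantelli lemma applied to disjoint blocks. -/
lemma ae_exists_run {g : ℕ → ℤ ⊕ ℤ} (hg : Function.Injective g) {s : ℤ} (hs : s = -1 ∨ s = 1)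
    {L : ℕ} (hL : 0 < L) :
    ∀ᵐ w ∂signLaw, ∀ N, ∃ n ≥ N, ∀ k < L, w (g (n * L + k)) = s := by
  classical
  let A : ℕ → Set (ℤ ⊕ ℤ → ℤ) := fun n => {w | ∀ k < L, w (g (n * L + k)) = s}
  have hblock : Set.InjOn (fun a : ℕ × ℕ => g (a.1 * L + a.2)) {a | a.2 < L} := by
    rintro ⟨n, k⟩ hk ⟨n', k'⟩ hk' h
    have h1 : n * L + k = n' * L + k' := hg h
    have h2 : n = n' := by
      have := congrArg (· / L) h1
      simpa [Nat.mul_add_div hL, mul_comm _ L, Nat.div_eq_of_lt hk, Nat.div_eq_of_lt hk'] using this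
    subst h2
    simpa using h1
  let T : Finset ℕ → Finset (ℤ ⊕ ℤ) := fun S =>
    (S ×ˢ Finset.range L).image fun a => g (a.1 * L + a.2)
  have hT : ∀ S, (T S).card = S.card * L := fun S => by
    rw [Finset.card_image_of_injOn, Finset.card_product, Finset.card_range]
    exact hblock.mono fun a ha => by simpa using (Finset.mem_product.1 ha).2
  have hA : ∀ S : Finset ℕ, ⋂ n ∈ S, A n = Set.pi (T S) fun _ => {s} := fun S => by
    ext w
    simp only [A, T, Set.mem_iInter, Set.mem_pi, Finset.mem_coe, Finset.mem_image,
      Finset.mem_product, Finset.mem_range, Set.mem_singleton_iff, Set.mem_ofPred_eq]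
    constructor
    · rintro h _ ⟨⟨n, k⟩, ⟨hn, hk⟩, rfl⟩
      exact h n hn k hk
    · intro h n hn k hk
      exact h _ ⟨(n, k), ⟨hn, hk⟩, rfl⟩
  have hmeas : ∀ S : Finset ℕ, signLaw (⋂ n ∈ S, A n) = (2⁻¹ ^ L) ^ S.card := fun S => by
    rw [hA, signLaw, Measure.infinitePi_pi _ fun _ _ => measurableSet_singleton _,
      Finset.prod_const, coin_singleton hs, hT, mul_comm, pow_mul]
  have hAmeas : ∀ n, MeasurableSet (A n) := fun n => by
    have := hA {n}
    simp only [Finset.mem_singleton, Set.iInter_iInter_eq_left] at this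
    rw [this]
    exact .pi (Finset.countable_toSet _) fun _ _ => measurableSet_singleton _
  have hone : ∀ n, signLaw (A n) = 2⁻¹ ^ L := fun n => by simpa using hmeas {n}
  have hind : iIndepSet A signLaw := by
    rw [iIndepSet_iff_meas_biInter hAmeas]
    intro S
    rw [hmeas, Finset.prod_congr rfl fun n _ => hone n, Finset.prod_const]
  have hlim : signLaw (Filter.limsup A Filter.atTop) = 1 := by
    refine measure_limsup_eq_one hAmeas hind ?_
    simp only [hone]
    exact ENNReal.tsum_const_eq_top_of_ne_zero (by simp)
  have hae : ∀ᵐ w ∂signLaw, w ∈ Filter.limsup A Filter.atTop :=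
    (prob_compl_eq_zero_iff (MeasurableSet.measurableSet_limsup hAmeas)).2 hlim
  filter_upwards [hae] with w hw N
  rw [Filter.mem_limsup_iff_frequently_mem, Filter.frequently_atTop] at hw
  exact hw N

lemma measurable_eval_comp (e : ℤ → ℤ ⊕ ℤ) {g : (ℤ ⊕ ℤ → ℤ) → ℤ} (hg : Measurable g) :
    Measurable fun w : ℤ ⊕ ℤ → ℤ => w (e (g w)) := by
  have : Measurable fun a : ℤ × (ℤ ⊕ ℤ → ℤ) => a.2 (e a.1) :=
    measurable_from_prod_countable_right fun k => measurable_pi_apply (e k)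
  exact this.comp (hg.prodMk measurable_id)

lemma measurable_iterate_step (p : ℤ × ℤ) (n : ℕ) :
    Measurable fun w => (step (rows w) (cols w))^[n] p := by
  induction n with
  | zero => exact measurable_const
  | succ n ih =>
    simp only [Function.iterate_succ_apply']
    exact (ih.fst.add (measurable_eval_comp .inl ih.snd)).prodMk
      (ih.snd.add (measurable_eval_comp .inr ih.fst))

lemma measurableSet_isTopRow (p : ℤ × ℤ) (M : ℤ) :
    MeasurableSet {w | IsTopRow (rows w) (cols w) p M} := by
  refine MeasurableSet.inter ?_ ?_
  · refine MeasurableSet.congr (MeasurableSet.iUnion fun n =>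
      (measurable_iterate_step p n).snd (measurableSet_singleton M)) ?_
    ext w
    simp only [Set.mem_iUnion]
    rfl
  · refine MeasurableSet.congr (MeasurableSet.iInter fun n =>
      (measurable_iterate_step p n).snd (measurableSet_Iic (a := M))) ?_
    ext w
    simp only [Set.mem_iInter]
    rfl

lemma measurableSet_mem_basin (p q : ℤ × ℤ) :
    MeasurableSet {w | p ∈ basin (rows w) (cols w) q} := by
  refine MeasurableSet.congr (MeasurableSet.iUnion fun n =>
    (measurable_iterate_step p n (measurableSet_singleton q)).inter
      ((measurable_iterate_step q 2 (measurableSet_singleton q)).inter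
        (measurable_pi_apply (.inr q.1) (measurableSet_singleton (1 : ℤ))))) ?_
  ext w
  simp only [Set.mem_iUnion]
  rfl

/-! ### Almost sure boundedness of forward paths -/

/-- Almost surely, every walk is bounded above. Reversing row `M` maps the event of a walk
unbounded above with a peak in row `M` into the event of a walk with top row `M`. The latter events
are disjoint, so by Borel–Cantelli a walk unbounded above has only finitely many peaks. -/
theorem ae_boundedAbove : ∀ᵐ w ∂signLaw, BoundedAbove (rows w) (cols w) := by
  have hrun : ∀ᵐ w ∂signLaw, ∀ (L : ℕ) (M₀ : ℤ), ∃ M ≥ M₀, ∀ k : ℕ, k < L → rows w (M + k) = 1 := by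
    refine ae_all_iff.2 fun L => ?_
    have hg : Function.Injective fun n : ℕ => (Sum.inl (n : ℤ) : ℤ ⊕ ℤ) := fun m n h => by
      simpa using h
    filter_upwards [ae_exists_run hg (Or.inr rfl) L.succ_pos] with w hw M₀
    obtain ⟨n, hn, h⟩ := hw M₀.toNat
    refine ⟨(n * L.succ : ℕ), ?_, fun k hk => ?_⟩
    · have : n ≤ n * L.succ := Nat.le_mul_of_pos_right n L.succ_pos
      omega
    · have := h k (by omega)
      push_cast at this ⊢
      exact this
  have hright : ∀ᵐ w ∂signLaw, ∀ x, ∃ r ≥ x, cols w r = -1 := by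
    have hg : Function.Injective fun n : ℕ => (Sum.inr (n : ℤ) : ℤ ⊕ ℤ) := fun m n h => by
      simpa using h
    filter_upwards [ae_exists_run hg (Or.inl rfl) one_pos] with w hw x
    obtain ⟨n, hn, h⟩ := hw x.toNat
    exact ⟨n, by omega, by simpa [cols] using h 0 one_pos⟩
  have hleft : ∀ᵐ w ∂signLaw, ∀ x, ∃ l ≤ x, cols w l = -1 := by
    have hg : Function.Injective fun n : ℕ => (Sum.inr (-(n : ℤ)) : ℤ ⊕ ℤ) := fun m n h => by
      simpa using h
    filter_upwards [ae_exists_run hg (Or.inl rfl) one_pos] with w hw x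
    obtain ⟨n, hn, h⟩ := hw (-x).toNat
    exact ⟨-n, by omega, by simpa [cols] using h 0 one_pos⟩
  refine ae_all_iff.2 fun p => ?_
  let flip : ℤ → (ℤ ⊕ ℤ → ℤ) → ℤ ⊕ ℤ → ℤ := fun M w i => (if i = .inl M then -1 else 1) * w i
  have hflip : ∀ M, MeasurePreserving (flip M) signLaw signLaw := fun M =>
    measurePreserving_signed (Equiv.refl _) fun i => by split_ifs <;> simp
  let A : ℤ → Set (ℤ ⊕ ℤ → ℤ) := fun M => {w | (∀ i, w i = -1 ∨ w i = 1) ∧ p.2 < M ∧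
    (¬ ∃ M', ∀ n, ((step (rows w) (cols w))^[n] p).2 ≤ M') ∧ IsPeak (rows w) (cols w) p M}
  have hAle : ∀ M, signLaw (A M) ≤ signLaw {w | IsTopRow (rows w) (cols w) p M} := fun M => by
    rw [← (hflip M).measure_preimage (measurableSet_isTopRow p M).nullMeasurableSet]
    refine measure_mono ?_
    rintro w ⟨hw, hpM, hub, hpeak⟩
    have h := hpeak.isTopRow_update (fun x => hw _) (fun y => hw _) hpM fun h => hub ⟨M, h⟩
    have e1 : rows (flip M w) = Function.update (rows w) M (-rows w M) := by
      ext y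
      by_cases hy : y = M
      · subst hy
        simp [rows, flip]
      · simp [rows, flip, hy]
    have e2 : cols (flip M w) = cols w := by
      ext x
      simp [cols, flip]
    change IsTopRow (rows (flip M w)) (cols (flip M w)) p M
    rwa [e1, e2]
  have hsum : ∑' M, signLaw (A M) ≠ ∞ := by
    refine ne_top_of_le_ne_top ENNReal.one_ne_top ((ENNReal.tsum_le_tsum hAle).trans ?_)
    rw [← measure_univ (μ := signLaw)]
    refine tsum_measure_le_measure_univ
      (fun M => (measurableSet_isTopRow p M).nullMeasurableSet) fun M M' hMM => ?_
    exact (Set.disjoint_left.2 fun w h h' => hMM (IsTopRow.unique h h')).aedisjoint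
  filter_upwards [signLaw_ae, hrun, hright, hleft, ae_finite_setOfPred_mem hsum]
    with w hw hrun hright hleft hfin
  by_contra hub
  obtain ⟨B, hB⟩ := hfin.bddAbove
  have hub' : ∀ M, ∃ n, M ≤ ((step (rows w) (cols w))^[n] p).2 := fun M => by
    by_contra! h
    exact hub ⟨M, fun n => (h n).le⟩
  obtain ⟨M, hM, hpeak⟩ := exists_isPeak (fun x => hw _) (fun y => hw _) hrun hright hleft hub'
    (max B p.2 + 1)
  have := hB (show M ∈ {M | w ∈ A M} from ⟨hw, by omega, hub, hpeak⟩)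
  omega

lemma iterate_step_swap (u v : ℤ → ℤ) (p : ℤ × ℤ) (n : ℕ) :
    (step v u)^[n] p.swap = ((step u v)^[n] p).swap :=
  ((show Function.Semiconj Prod.swap (step u v) (step v u) from fun _ => rfl).iterate_right n p).symm

lemma iterate_step_reflect (u v : ℤ → ℤ) (p : ℤ × ℤ) (n : ℕ) :
    (step (fun y => u (-y)) (fun x => -v x))^[n] (p.1, -p.2) =
      (((step u v)^[n] p).1, -((step u v)^[n] p).2) := by
  have h : Function.Semiconj (fun p : ℤ × ℤ => (p.1, -p.2)) (step u v)
      (step (fun y => u (-y)) (fun x => -v x)) := fun p => by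
    simp [step, add_comm]
  exact (h.iterate_right n p).symm

lemma iterate_step_translate (u v : ℤ → ℤ) (p q : ℤ × ℤ) (n : ℕ) :
    (step u v)^[n] (q + p) = (step (fun y => u (y + p.2)) (fun x => v (x + p.1)))^[n] q + p := by
  have h : Function.Semiconj (fun q : ℤ × ℤ => q + p)
      (step (fun y => u (y + p.2)) (fun x => v (x + p.1))) (step u v) := fun q => by
    simp only [step]
    ext <;> simp <;> ring
  exact (h.iterate_right n q).symm

/-- Almost surely, all forward paths are bounded: the law is invariant under the symmetries of the
square. -/
theorem ae_finite_orbits :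
    ∀ᵐ w ∂signLaw, ∀ p, (Set.range fun n => (step (rows w) (cols w))^[n] p).Finite := by
  have hvert : ∀ᵐ w ∂signLaw, ∀ p, ∃ M M', ∀ n, M ≤ ((step (rows w) (cols w))^[n] p).2 ∧
      ((step (rows w) (cols w))^[n] p).2 ≤ M' := by
    have hrefl := measurePreserving_signed (Equiv.sumCongr (Equiv.neg ℤ) (Equiv.refl ℤ))
      (ε := Sum.elim (fun _ => 1) (fun _ => -1)) (by rintro (_ | _) <;> simp)
    filter_upwards [ae_boundedAbove, hrefl.quasiMeasurePreserving.ae ae_boundedAbove]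
      with w h1 h2 p
    obtain ⟨M', hM'⟩ := h1 p
    obtain ⟨M, hM⟩ := h2 (p.1, -p.2)
    refine ⟨-M, M', fun n => ⟨?_, hM' n⟩⟩
    have e := iterate_step_reflect (rows w) (cols w) p n
    have h := hM n
    have e1 : rows (fun i => Sum.elim (fun _ => 1) (fun _ => -1) i *
        w ((Equiv.sumCongr (Equiv.neg ℤ) (Equiv.refl ℤ)) i)) = fun y => rows w (-y) := by
      ext y
      simp [rows]
    have e2 : cols (fun i => Sum.elim (fun _ => 1) (fun _ => -1) i *
        w ((Equiv.sumCongr (Equiv.neg ℤ) (Equiv.refl ℤ)) i)) = fun x => -cols w x := by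
      ext x
      simp [cols]
    rw [e1, e2, e] at h
    simp only at h
    omega
  have hswap := measurePreserving_signed (Equiv.sumComm ℤ ℤ) (ε := fun _ => 1) (by simp)
  filter_upwards [hvert, hswap.quasiMeasurePreserving.ae hvert] with w h1 h2 p
  obtain ⟨M, M', hM⟩ := h1 p
  obtain ⟨K, K', hK⟩ := h2 p.swap
  have e1 : rows (fun i => 1 * w (Equiv.sumComm ℤ ℤ i)) = cols w := by
    ext y
    simp [rows, cols]
  have e2 : cols (fun i => 1 * w (Equiv.sumComm ℤ ℤ i)) = rows w := by
    ext y
    simp [rows, cols]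
  rw [e1, e2] at hK
  refine (Set.finite_Icc (K, M) (K', M')).subset (Set.range_subset_iff.2 fun n => ?_)
  have h := hK n
  rw [iterate_step_swap] at h
  exact ⟨⟨h.1, (hM n).1⟩, ⟨h.2, (hM n).2⟩⟩

/-! ### Finiteness of the basins, and the joint law of the orientations -/

/-- Almost surely, all basins are finite. By invariance under translations, the expected size of the
basin of `q` is the expected number of trap endpoints, with upward direction, that are reached from
the origin, which is at most one. -/
theorem ae_finite_basins : ∀ᵐ w ∂signLaw, ∀ q, (basin (rows w) (cols w) q).Finite := by
  refine ae_all_iff.2 fun q => ?_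
  have htrans : ∀ p, signLaw {w | p ∈ basin (rows w) (cols w) q} =
      signLaw {w | 0 ∈ basin (rows w) (cols w) (q - p)} := fun p => by
    have h := measurePreserving_signed
      (Equiv.sumCongr (Equiv.addRight p.2) (Equiv.addRight p.1)) (ε := fun _ => 1) (by simp)
    rw [← h.measure_preimage (measurableSet_mem_basin 0 (q - p)).nullMeasurableSet]
    congr 1
    ext w
    have e1 : rows (fun i => 1 * w ((Equiv.sumCongr (Equiv.addRight p.2) (Equiv.addRight p.1)) i)) =
        fun y => rows w (y + p.2) := by
      ext y
      simp [rows]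
    have e2 : cols (fun i => 1 * w ((Equiv.sumCongr (Equiv.addRight p.2) (Equiv.addRight p.1)) i)) =
        fun x => cols w (x + p.1) := by
      ext y
      simp [cols]
    simp only [Set.mem_preimage, Set.mem_ofPred_eq, e1, e2, basin]
    have t1 : ∀ n, (step (rows w) (cols w))^[n] p = q ↔
        (step (fun y => rows w (y + p.2)) (fun x => cols w (x + p.1)))^[n] 0 = q - p := fun n => by
      rw [eq_sub_iff_add_eq, ← iterate_step_translate, zero_add]
    have t2 : step (rows w) (cols w) (step (rows w) (cols w) q) = q ↔
        step (fun y => rows w (y + p.2)) (fun x => cols w (x + p.1))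
          (step (fun y => rows w (y + p.2)) (fun x => cols w (x + p.1)) (q - p)) = q - p := by
      have := iterate_step_translate (rows w) (cols w) p (q - p) 2
      rw [sub_add_cancel] at this
      rw [eq_sub_iff_add_eq]
      exact Eq.congr_left this
    simp only [t1, t2, Prod.fst_sub, sub_add_cancel]
  have hsum : ∑' p, signLaw {w | p ∈ basin (rows w) (cols w) q} ≠ ∞ := by
    simp only [htrans]
    refine ne_top_of_le_ne_top ENNReal.one_ne_top ?_
    rw [← measure_univ (μ := signLaw)]
    refine tsum_measure_le_measure_univ
      (fun p => (measurableSet_mem_basin 0 (q - p)).nullMeasurableSet) fun p p' hpp => ?_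
    have hdisj : Disjoint {w | 0 ∈ basin (rows w) (cols w) (q - p)}
        {w | 0 ∈ basin (rows w) (cols w) (q - p')} :=
      Set.disjoint_left.2 fun w h h' => hpp (sub_right_injective (basin_unique h h'))
    exact hdisj.aedisjoint
  exact ae_finite_setOfPred_mem hsum

/-- The joint law of the orientations. -/
lemma map_orientations {Ω : Type*} [MeasurableSpace Ω] {P : Measure Ω} [IsProbabilityMeasure P]
    {X : ℤ ⊕ ℤ → Ω → ℤ} (hX : ∀ i, Measurable (X i)) (hval : ∀ i ξ, X i ξ = -1 ∨ X i ξ = 1)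
    (hsymm : ∀ i, IdentDistrib (X i) (fun ξ => -X i ξ) P P) (hindep : iIndepFun X P) :
    P.map (fun ξ i => X i ξ) = signLaw := by
  rw [hindep.map_fun_eq_infinitePi_map hX, signLaw]
  congr 1
  ext1 i
  have := Measure.isProbabilityMeasure_map (μ := P) (hX i).aemeasurable
  refine coin_eq_of_symm ?_ ?_
  · rw [ae_map_iff (hX i).aemeasurable (by measurability)]
    exact .of_forall (hval i)
  · rw [Measure.map_map (by fun_prop) (hX i)]
    exact (hsymm i).map_eq.symm

end Manhattan

theorem theorem2 {Ω : Type*} [MeasurableSpace Ω] (P : Measure Ω) [IsProbabilityMeasure P]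
    (U V : ℤ → Ω → ℤ)
    (hU : ∀ y, Measurable (U y)) (hV : ∀ x, Measurable (V x))
    (hU_val : ∀ y ξ, U y ξ = -1 ∨ U y ξ = 1) (hV_val : ∀ x ξ, V x ξ = -1 ∨ V x ξ = 1)
    (hU_symm : ∀ y, IdentDistrib (U y) (fun ξ => -U y ξ) P P)
    (hV_symm : ∀ x, IdentDistrib (V x) (fun ξ => -V x ξ) P P)
    (h_indep : iIndepFun (Sum.elim U V) P) :
    ∀ᵐ ξ ∂P,
      (∀ C : (Manhattan.graph (Manhattan.omega (U · ξ) (V · ξ))).ConnectedComponent,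
        Bornology.IsBounded C.supp ∧
        (∃! t : Sym2 (ℤ × ℤ), Manhattan.IsTrap (Manhattan.omega (U · ξ) (V · ξ)) t ∧
          Manhattan.Contains C t)) ∧
      (∀ C : (Manhattan.graph (Manhattan.omega (U · ξ) (V · ξ))).ConnectedComponent,
        ∃ t : Sym2 (ℤ × ℤ), Manhattan.IsTrap (Manhattan.omega (U · ξ) (V · ξ)) t ∧
          Manhattan.IsFiniteTreeRootedAt C t) ∧
      ¬ ∃ a : ℕ → ℤ × ℤ, Manhattan.IsPathFromInfinity (Manhattan.omega (U · ξ) (V · ξ)) a := by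
  have hX : ∀ i, Measurable (Sum.elim U V i) := by rintro (y | x) <;> simp [hU, hV]
  have hlaw := Manhattan.map_orientations (P := P) hX
    (by rintro (y | x) ξ <;> simp [hU_val, hV_val])
    (by rintro (y | x); exacts [hU_symm y, hV_symm x]) h_indep
  have h := Manhattan.ae_finite_orbits.and Manhattan.ae_finite_basins
  rw [← hlaw] at h
  filter_upwards [ae_of_ae_map (measurable_pi_lambda _ hX).aemeasurable h] with ξ hξ
  exact Manhattan.components_of_finite (fun y => hU_val y ξ) (fun x => hV_val x ξ) hξ.1 hξ.2
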